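/- Let $1\le N_B\le N_E<N_A$ and $d\ge 2$ be integers. Let $H\in\mathbb{C}^{N_B\times N_A}$ be any matrix (Bob's channel) with singular value decomposition $H=U\Lambda V^H$, and write $V=[V_1,Z]$, where $V_1$ consists of the first $N_B$ columns of the unitary matrix $V$. Let $G\in\mathbb{C}^{N_E\times N_A}$ (Eve's channel) have i.i.d. $\mathcal{N}_{\mathbb{C}}(0,1)$ entries. Let the message $u$ be a random vector in $\mathbb{Z}[i]^{N_B}$ and the artificial noise $v$ a random vector in $\mathbb{C}^{N_A-N_B}$ of arbitrary distribution with $\|v\|^2\le P_v$; $u$, $v$ and $G$ are mutually independent. Eve, over a noiseless channel, receives $y=GV_1u+GZv$. Let $\Lambda_{\mathbb{C}}=\{GV_1w : w\in\mathbb{Z}[i]^{N_B}\}$, let $R_{\max}=\max_{\|w\|^2\le P_v}\|GZw\|$, and let $D$ be the number of points of $\Lambda_{\mathbb{C}}$ in the closed ball of radius $R_{\max}$ centred at $y$. The secrecy outage probability is $P_{\mathrm{out}}(d)=\Pr\{D<d\}$. Put $$\kappa(d)=\frac{d^{1/(2N_E)}}{\sqrt{\pi}},\qquad \Phi=\left[\frac{(N_E-N_B)!}{N_E!}\right]^{1/(2N_B)},\qquad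 N_{\min}=\min\{N_E-N_B+1,\,N_B\}.$$ There is a constant $C$, depending only on $N_B$, $N_E$ and $d$, such that for every $\varepsilon>0$ and every $$P_v\ \ge\ \varepsilon^{-2/N_{\min}}\,\frac{\kappa(d)^2}{\Phi^{2N_B/N_E}}$$ we have $P_{\mathrm{out}}(d)<C\varepsilon$, that is, $P_{\mathrm{out}}(d)=O(\varepsilon)$. Moreover, if every $w\in\mathbb{Z}[i]^{N_B}$ has positive probability as a message, then with probability greater than $1-C\varepsilon$ ideal secrecy holds, that is, $H(u|y)\ne 0$ and $H(k|y)\ne 0$. Here the effective key $k$ is the index for which $GV_1u$ is the $k$-th closest point of $\Lambda_{\mathbb{C}}$ to $y$ (ties being broken by any fixed rule), Eve's posterior law of $u$ given $y$ is the law of $u$ conditioned on $u\in\mathcal{U}=\{u':\|GV_1u'-y\|\le R_{\max}\}$, her posterior law of $k$ is the induced one, and $H(u|y)$, $H(k|y)$ are the Shannon entropies of these posterior laws. -/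

import Mathlib

open MeasureTheory ProbabilityTheory
open scoped NNReal ENNReal Matrix

noncomputable section

namespace USK

/-- All sets of Gaussian integers are measurable. -/
instance instMeasurableSpaceGaussianInt : MeasurableSpace GaussianInt := ⊤

instance instDiscreteMeasurableSpaceGaussianInt : DiscreteMeasurableSpace GaussianInt :=
  ⟨fun _ => trivial⟩

/-- The circularly symmetric complex Gaussian law of mean `0` and variance `s`: real and imaginary
parts are independent centred real Gaussians of variance `s / 2`. -/
def complexGaussian (s : ℝ≥0) : Measure ℂ :=
  ((gaussianReal 0 (s / 2)).prod (gaussianReal 0 (s / 2))).map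
    Complex.measurableEquivRealProd.symm

/-- `H = U S Vᴴ` is a singular value decomposition: `U`, `V` are unitary and `S` is a rectangular
diagonal matrix with nonnegative real diagonal entries. -/
structure IsSVD {NB NA : ℕ} (H : Matrix (Fin NB) (Fin NA) ℂ) (U : Matrix (Fin NB) (Fin NB) ℂ)
    (S : Matrix (Fin NB) (Fin NA) ℂ) (V : Matrix (Fin NA) (Fin NA) ℂ) : Prop where
  unitary_left : U ∈ Matrix.unitaryGroup (Fin NB) ℂ
  unitary_right : V ∈ Matrix.unitaryGroup (Fin NA) ℂ
  off_diag : ∀ (i : Fin NB) (j : Fin NA), (i : ℕ) ≠ (j : ℕ) → S i j = 0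
  diag_nonneg : ∀ (i : Fin NB) (j : Fin NA), (i : ℕ) = (j : ℕ) →
    ∃ r : ℝ, 0 ≤ r ∧ S i j = (r : ℂ)
  eq_mul : H = U * S * Vᴴ

/-- The block `V₁` of the first `NB` columns of `V`, which carries the message. -/
def messageBlock {NA NB : ℕ} (h : NB ≤ NA) (V : Matrix (Fin NA) (Fin NA) ℂ) :
    Matrix (Fin NA) (Fin NB) ℂ :=
  V.submatrix id (Fin.castLE h)

/-- The block `Z` of the last `NA - NB` columns of `V`, which carries the artificial noise. -/
def noiseBlock {NA NB : ℕ} (h : NB ≤ NA) (V : Matrix (Fin NA) (Fin NA) ℂ) :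
    Matrix (Fin NA) (Fin (NA - NB)) ℂ :=
  V.submatrix id (fun j => (⟨NB + j, by omega⟩ : Fin NA))

section Eve

/-! Here `A` stands for `G V₁` and `B` for `G Z`. -/

variable {NE NB m : ℕ}

/-- The lattice point `A u` of a Gaussian integer vector `u`. -/
def latticePoint (A : Matrix (Fin NE) (Fin NB) ℂ) (u : Fin NB → GaussianInt) :
    EuclideanSpace ℂ (Fin NE) :=
  WithLp.toLp 2 (A *ᵥ fun i => GaussianInt.toComplex (u i))

/-- The complex lattice generated by the columns of `A`. -/
def lattice (A : Matrix (Fin NE) (Fin NB) ℂ) : Set (EuclideanSpace ℂ (Fin NE)) :=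
  Set.range (latticePoint A)

/-- The image `B v` of an artificial noise vector `v`. -/
def noisePoint (B : Matrix (Fin NE) (Fin m) ℂ) (v : EuclideanSpace ℂ (Fin m)) :
    EuclideanSpace ℂ (Fin NE) :=
  WithLp.toLp 2 (B *ᵥ v.ofLp)

/-- The signal `y = A u + B v` that Eve receives over a noiseless channel. -/
def received (A : Matrix (Fin NE) (Fin NB) ℂ) (B : Matrix (Fin NE) (Fin m) ℂ)
    (u : Fin NB → GaussianInt) (v : EuclideanSpace ℂ (Fin m)) : EuclideanSpace ℂ (Fin NE) :=
  latticePoint A u + noisePoint B v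

/-- `R_max`, the maximum of `‖B v‖` over `‖v‖² ≤ Pv`. -/
def maxRadius (B : Matrix (Fin NE) (Fin m) ℂ) (Pv : ℝ) : ℝ :=
  sSup ((fun v => ‖noisePoint B v‖) '' {v : EuclideanSpace ℂ (Fin m) | ‖v‖ ^ 2 ≤ Pv})

/-- The effective key space size `D`: the number of lattice points in the closed ball of radius
`R_max` centred at the received signal `y`. -/
def keySpaceSize (A : Matrix (Fin NE) (Fin NB) ℂ) (B : Matrix (Fin NE) (Fin m) ℂ) (Pv : ℝ)
    (y : EuclideanSpace ℂ (Fin NE)) : ℕ∞ :=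
  (Metric.closedBall y (maxRadius B Pv) ∩ lattice A).encard

/-- The messages whose lattice point lies in that ball: what Eve learns from `y` is exactly that
the message belongs to this set. -/
def candidates (A : Matrix (Fin NE) (Fin NB) ℂ) (B : Matrix (Fin NE) (Fin m) ℂ) (Pv : ℝ)
    (y : EuclideanSpace ℂ (Fin NE)) : Set (Fin NB → GaussianInt) :=
  {u | latticePoint A u ∈ Metric.closedBall y (maxRadius B Pv)}

/-- The effective key of the message `u`: the `k` for which `A u` is the `k`-th closest lattice
point to `y`; lattice points at equal distance are ordered by the injective rule `τ`. -/
def keyIndex (τ : (Fin NB → GaussianInt) → ℕ) (A : Matrix (Fin NE) (Fin NB) ℂ)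
    (y : EuclideanSpace ℂ (Fin NE)) (u : Fin NB → GaussianInt) : ℕ :=
  1 + {w : Fin NB → GaussianInt | dist (latticePoint A w) y < dist (latticePoint A u) y ∨
    (dist (latticePoint A w) y = dist (latticePoint A u) y ∧ τ w < τ u)}.ncard

end Eve

/-- Shannon entropy (in nats) of a probability mass function. -/
def entropy {α : Type*} (p : α → ℝ≥0∞) : ℝ≥0∞ :=
  ∑' a, ENNReal.ofReal (Real.negMulLog (p a).toReal)

open Classical in
/-- The mass function `p` conditioned on the set `s`. -/
def conditioned {α : Type*} (p : α → ℝ≥0∞) (s : Set α) (a : α) : ℝ≥0∞ :=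
  if a ∈ s then p a / ∑' b : s, p b else 0

open Classical in
/-- The image of the mass function `p` under the map `f`. -/
def pushforward {α β : Type*} (f : α → β) (p : α → ℝ≥0∞) (b : β) : ℝ≥0∞ :=
  ∑' a, if f a = b then p a else 0

/-- Ideal secrecy at the cryptogram `y`, for messages with a-priori mass function `p`: neither
Eve's equivocation `H(u|y)` about the message nor her equivocation `H(k|y)` about the effective key
vanishes. Her a-posteriori law of the message is `p` conditioned on the candidates, and the one of
the key is its image under the key index. -/
def IdealSecrecy {NE NB m : ℕ} (τ : (Fin NB → GaussianInt) → ℕ)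
    (p : (Fin NB → GaussianInt) → ℝ≥0∞)
    (A : Matrix (Fin NE) (Fin NB) ℂ) (B : Matrix (Fin NE) (Fin m) ℂ) (Pv : ℝ)
    (y : EuclideanSpace ℂ (Fin NE)) : Prop :=
  entropy (conditioned p (candidates A B Pv y)) ≠ 0 ∧
    entropy (pushforward (keyIndex τ A y) (conditioned p (candidates A B Pv y))) ≠ 0

/-- `κ(d) = d^{1/(2 NE)} / √π`. -/
def kappa (NE d : ℕ) : ℝ := (d : ℝ) ^ (1 / (2 * (NE : ℝ))) / √Real.pi

/-- `Φ = [(NE - NB)! / NE!]^{1/(2 NB)}` (for `NB ≤ NE`). -/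
def Phi (NB NE : ℕ) : ℝ :=
  (((NE - NB).factorial : ℝ) / (NE.factorial : ℝ)) ^ (1 / (2 * (NB : ℝ)))

/-- `N_min = min {NE - NB + 1, NB}` (for `NB ≤ NE`). -/
def Nmin (NB NE : ℕ) : ℕ := min (NE - NB + 1) NB

/-- The artificial noise power `ε^{-2/N_min} κ(d)² / Φ^{2 NB/NE}`. -/
def powerThreshold (NB NE d : ℕ) (ε : ℝ) : ℝ :=
  ε ^ (-2 / (Nmin NB NE : ℝ)) * kappa NE d ^ 2 / Phi NB NE ^ (2 * (NB : ℝ) / (NE : ℝ))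

end USK

end

noncomputable section

namespace USK

/-! Write `A = G V₁`, `B = G Z`, let `e` be the unit direction of the noise `v` and `g = B e`. Then
`y = A u + ‖v‖ g`, and `R_max ≥ √Pv ‖g‖` because `√Pv e` is itself an admissible noise vector. Let
`P` be the orthogonal projection of `g` on the column span of `A`. Since `‖v‖ ≤ √Pv`, the component
of `‖v‖ g` orthogonal to that span is at most `√Pv ‖g - P‖`, so by Pythagoras `A (u + w)` lies in
Eve's ball as soon as `‖A w - ‖v‖ P‖ ≤ √Pv ‖P‖`. Rounding the coordinates of `‖v‖ P` to Gaussian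
integers and shifting one of them by `0, ..., d - 1` gives `d` such `w`, provided `√Pv ‖P‖ ≥ K ‖A‖`
with `K = NE NB (1 + d)` (`exists_many_near`, `exists_candidates`).

An outage thus forces `P` to be short. The vectors `V₁` and `Z e` are orthonormal, so `g` and the
columns of `A` are independent Gaussian vectors (`map_mulColumns`). Given `A`, the `NB` coordinates
of `P` in an orthonormal basis are independent complex Gaussians, all small with probability at most
`(2 K ‖A‖ / √Pv) ^ (2 NB)`. Averaging over `A` costs a finite Gaussian moment and leaves a multiple
of `Pv ^ (-NB)` (`gaussianColumns_shortProjection_le`), which the power threshold makes `O(ε)`.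

Ideal secrecy follows from having two candidates: the posterior is then not a point mass, and
injectivity of the key index carries this over to the key. -/

/-! ### The one-dimensional complex Gaussian: characteristic function and small balls. -/

lemma complexGaussian_eq_map (s : ℝ≥0) :
    complexGaussian s = ((gaussianReal 0 (s / 2)).prod (gaussianReal 0 (s / 2))).map
      Complex.equivRealProdCLM.symm := rfl

instance isGaussian_complexGaussian (s : ℝ≥0) : IsGaussian (complexGaussian s) := by
  rw [complexGaussian_eq_map]
  infer_instance

lemma charFunDual_complexGaussian_one (L : StrongDual ℝ ℂ) :
    charFunDual (complexGaussian 1) L =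
      Complex.exp (-(((L 1) ^ 2 + (L Complex.I) ^ 2 : ℝ) : ℂ) / 4) := by
  have hL : ∀ p : ℝ × ℝ, L (Complex.equivRealProdCLM.symm p) = p.1 * L 1 + p.2 * L Complex.I := by
    intro p
    have : Complex.equivRealProdCLM.symm p = p.1 • (1 : ℂ) + p.2 • Complex.I := by
      apply Complex.ext
      · change p.1 = _
        simp
      · change p.2 = _
        simp
    rw [this, map_add, map_smul, map_smul, smul_eq_mul, smul_eq_mul]
  rw [charFunDual_apply, complexGaussian_eq_map,
    integral_map (Measurable.aemeasurable (by fun_prop)) (by fun_prop)]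
  have hchar : ∀ t : ℝ, ∫ x, Complex.exp (t * x * Complex.I) ∂(gaussianReal 0 (1 / 2)) =
      Complex.exp (-(t : ℂ) ^ 2 / 4) := by
    intro t
    rw [← charFun_apply_real, charFun_gaussianReal]
    congr 1
    push_cast
    ring
  calc ∫ p, Complex.exp (L (Complex.equivRealProdCLM.symm p) * Complex.I)
        ∂((gaussianReal 0 (1 / 2)).prod (gaussianReal 0 (1 / 2)))
      = ∫ p, Complex.exp ((L 1 : ℂ) * (p.1 : ℂ) * Complex.I) *
          Complex.exp ((L Complex.I : ℂ) * (p.2 : ℂ) * Complex.I)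
          ∂((gaussianReal 0 (1 / 2)).prod (gaussianReal 0 (1 / 2))) := by
        refine integral_congr_ae (.of_forall fun p => ?_)
        simp only [hL]
        rw [← Complex.exp_add]
        congr 1
        push_cast
        ring
    _ = _ := by
        rw [integral_prod_mul (fun x : ℝ => Complex.exp ((L 1 : ℂ) * (x : ℂ) * Complex.I))
          (fun x : ℝ => Complex.exp ((L Complex.I : ℂ) * (x : ℂ) * Complex.I)), hchar, hchar,
          ← Complex.exp_add]
        congr 1
        push_cast
        ring

/-- With variance `1 / 2` the density is at most `1 / √π ≤ 1`. -/
lemma gaussianReal_Icc_le (t : ℝ) :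
    gaussianReal 0 (1 / 2) (Set.Icc (-t) t) ≤ ENNReal.ofReal (2 * t) := by
  rw [gaussianReal_apply _ (by simp)]
  calc ∫⁻ x in Set.Icc (-t) t, gaussianPDF 0 (1 / 2) x
      ≤ ∫⁻ _ in Set.Icc (-t) t, 1 := by
        refine lintegral_mono fun x => ?_
        rw [gaussianPDF, ← ENNReal.ofReal_one]
        refine ENNReal.ofReal_le_ofReal ?_
        rw [gaussianPDFReal]
        refine mul_le_one₀ ?_ (Real.exp_nonneg _) ?_
        · refine inv_le_one_of_one_le₀ (Real.one_le_sqrt.2 ?_)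
          have := Real.pi_gt_three
          push_cast
          linarith
        · rw [Real.exp_le_one_iff]
          have : 0 ≤ (x - 0) ^ 2 / (2 * ((1 / 2 : ℝ≥0) : ℝ)) := by positivity
          rw [neg_div]
          linarith
    _ = ENNReal.ofReal (2 * t) := by
        rw [setLIntegral_one, Real.volume_Icc]
        congr 1
        ring

lemma complexGaussian_closedBall_le (t : ℝ) :
    complexGaussian 1 {z | ‖z‖ ≤ t} ≤ ENNReal.ofReal (2 * t) ^ 2 := by
  rw [complexGaussian_eq_map, Measure.map_apply (by fun_prop)
    (measurableSet_le (by fun_prop) (by fun_prop))]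
  calc _ ≤ ((gaussianReal 0 (1 / 2)).prod (gaussianReal 0 (1 / 2)))
        (Set.Icc (-t) t ×ˢ Set.Icc (-t) t) := by
        refine measure_mono fun p hp => ?_
        simp only [Set.mem_preimage, Set.mem_ofPred_eq] at hp
        have h1 := (Complex.abs_re_le_norm _).trans hp
        have h2 := (Complex.abs_im_le_norm _).trans hp
        exact ⟨abs_le.1 h1,
          abs_le.1 h2⟩
    _ ≤ _ := by
        rw [Measure.prod_prod, sq]
        exact mul_le_mul' (gaussianReal_Icc_le t) (gaussianReal_Icc_le t)

/-! ### Invariance of Gaussian vectors under coisometries. -/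

/-- The law of a family of independent standard complex Gaussians. -/
abbrev complexGaussianPi (ι : Type*) [Fintype ι] : Measure (ι → ℂ) :=
  Measure.pi fun _ => complexGaussian 1

/-- A real functional is `L z = Re ∑ c i * z i` with `c i = L (single i 1) - L (single i I) * I`. In
these complex coefficients, composing `L` with a matrix `M` turns `c` into `c ᵥ* M`. -/
lemma charFunDual_complexGaussianPi {ι : Type*} [Fintype ι] [DecidableEq ι]
    (L : StrongDual ℝ (ι → ℂ)) :
    charFunDual (complexGaussianPi ι) L = Complex.exp
      (-((∑ i, ‖((L (Pi.single i 1) : ℝ) : ℂ) - (L (Pi.single i Complex.I) : ℝ) * Complex.I‖ ^ 2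
        : ℝ) : ℂ) / 4) := by
  rw [charFunDual_pi]
  simp only [charFunDual_complexGaussian_one]
  rw [← Complex.exp_sum, Complex.ofReal_sum, ← Finset.sum_neg_distrib, Finset.sum_div]
  congr 1
  refine Finset.sum_congr rfl fun i _ => ?_
  congr 3
  rw [Complex.sq_norm, Complex.normSq_apply]
  simp
  ring

lemma ofReal_sum_norm_sq {ι : Type*} [Fintype ι] (w : ι → ℂ) :
    ((∑ i, ‖w i‖ ^ 2 : ℝ) : ℂ) = w ⬝ᵥ star w := by
  push_cast
  exact Finset.sum_congr rfl fun i _ => by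
    rw [Pi.star_apply, ← Complex.mul_conj']; rfl

/-- Coisometric images of standard complex Gaussian vectors are standard complex Gaussian. -/
lemma map_mulVec_complexGaussianPi {ι κ : Type*} [Fintype ι] [DecidableEq ι] [Fintype κ]
    [DecidableEq κ] (M : Matrix κ ι ℂ) (hM : M * Mᴴ = 1) :
    (complexGaussianPi ι).map (fun z => M *ᵥ z) = complexGaussianPi κ := by
  set T : (ι → ℂ) →L[ℝ] (κ → ℂ) :=
    LinearMap.toContinuousLinearMap ((Matrix.mulVecLin M).restrictScalars ℝ) with hT
  have hTa : ∀ z, T z = M *ᵥ z := fun z => rfl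
  have : IsProbabilityMeasure ((complexGaussianPi ι).map T) :=
    Measure.isProbabilityMeasure_map (by fun_prop)
  change (complexGaussianPi ι).map T = _
  refine Measure.ext_of_charFunDual ?_
  ext L
  rw [charFunDual_map, charFunDual_complexGaussianPi, charFunDual_complexGaussianPi]
  set c : κ → ℂ := fun k =>
    ((L (Pi.single k 1) : ℝ) : ℂ) - (L (Pi.single k Complex.I) : ℝ) * Complex.I with hc
  have hLc : ∀ z : κ → ℂ, L z = (∑ k, c k * z k).re := by
    intro z
    have hz : z = ∑ k, ((z k).re • (Pi.single k 1 : κ → ℂ) + (z k).im • (Pi.single k Complex.I : κ → ℂ)) := by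
      ext k
      simp only [Finset.sum_apply, Pi.add_apply, Pi.smul_apply, Pi.single_apply]
      rw [Finset.sum_eq_single k] <;> simp +contextual [eq_comm]
    conv_lhs => rw [hz]
    rw [map_sum, Complex.re_sum]
    refine Finset.sum_congr rfl fun k _ => ?_
    simp [hc]
    ring
  have hcol : ∀ i, (((L.comp T) (Pi.single i 1) : ℝ) : ℂ) -
      ((L.comp T) (Pi.single i Complex.I) : ℝ) * Complex.I = (c ᵥ* M) i := by
    intro i
    have h1 : (L.comp T) (Pi.single i 1) = ((c ᵥ* M) i).re := by
      rw [ContinuousLinearMap.comp_apply, hTa, hLc]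
      simp [Matrix.vecMul, dotProduct]
    have h2 : (L.comp T) (Pi.single i Complex.I) = -((c ᵥ* M) i).im := by
      rw [ContinuousLinearMap.comp_apply, hTa, hLc]
      simp only [Matrix.mulVec_single, Matrix.vecMul, dotProduct]
      rw [show ((∑ k, c k * (MulOpposite.op Complex.I • M.col i) k)) =
        (∑ k, c k * M k i) * Complex.I by
          rw [Finset.sum_mul]
          exact Finset.sum_congr rfl fun k _ => by simp [mul_assoc]]
      simp
    rw [h1, h2]
    apply Complex.ext <;> simp
  simp only [hcol]
  congr 4
  -- The characteristic function depends only on the Euclidean norm of `c`, which `M * Mᴴ = 1`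
  -- preserves.
  have hfin : (((∑ i, ‖(c ᵥ* M) i‖ ^ 2 : ℝ)) : ℂ) = ((∑ k, ‖c k‖ ^ 2 : ℝ) : ℂ) := by
    rw [ofReal_sum_norm_sq, ofReal_sum_norm_sq, Matrix.star_vecMul, Matrix.dotProduct_mulVec, Matrix.vecMul_vecMul, hM,
      Matrix.vecMul_one]
  exact_mod_cast hfin

/-- The coefficients of a standard complex Gaussian vector along an orthonormal family are
simultaneously small with small probability. -/
lemma complexGaussianPi_slab_le {n k : ℕ} (e : Fin k → EuclideanSpace ℂ (Fin n))
    (he : Orthonormal ℂ e) (t : ℝ) :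
    complexGaussianPi (Fin n) {g | ∀ i, ‖inner ℂ (e i) (WithLp.toLp 2 g)‖ ≤ t} ≤
      ENNReal.ofReal (2 * t) ^ (2 * k) := by
  set M : Matrix (Fin k) (Fin n) ℂ := Matrix.of fun i j => star (e i j) with hM
  have hin : ∀ i (g : Fin n → ℂ), inner ℂ (e i) (WithLp.toLp 2 g) = (M *ᵥ g) i := by
    intro i g
    simp [PiLp.inner_apply, Matrix.mulVec, dotProduct, hM, mul_comm]
  have hMM : M * Mᴴ = 1 := by
    ext i j
    have h := orthonormal_iff_ite.1 he i j
    rw [Matrix.one_apply, ← h, PiLp.inner_apply, Matrix.mul_apply]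
    exact Finset.sum_congr rfl fun l _ => by simp [hM, mul_comm]
  have hset : {g : Fin n → ℂ | ∀ i, ‖inner ℂ (e i) (WithLp.toLp 2 g)‖ ≤ t} =
      (fun z => M *ᵥ z) ⁻¹' (Set.univ.pi fun _ => {z : ℂ | ‖z‖ ≤ t}) := by
    ext g
    simp [hin]
  have hmeas : Measurable fun z : Fin n → ℂ => M *ᵥ z :=
    (Continuous.matrix_mulVec continuous_const continuous_id).measurable
  rw [hset, ← Measure.map_apply hmeas (MeasurableSet.univ_pi fun _ =>
    measurableSet_le (by fun_prop) (by fun_prop)), map_mulVec_complexGaussianPi M hMM,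
    Measure.pi_pi, pow_mul]
  calc _ ≤ ∏ _i : Fin k, ENNReal.ofReal (2 * t) ^ 2 :=
        Finset.prod_le_prod' fun i _ => complexGaussian_closedBall_le t
    _ = _ := by simp

/-! ### Gaussian columns: linear independence and short projections. -/

/-- The law of `k` independent standard complex Gaussian vectors of length `n`. -/
abbrev gaussianColumns (n k : ℕ) : Measure (Fin k → Fin n → ℂ) :=
  Measure.pi fun _ => complexGaussianPi (Fin n)

/-- The linear combination of the columns `c` with coefficients `x`. -/
def colComb {n k : ℕ} (c : Fin k → Fin n → ℂ) (x : Fin k → ℂ) : EuclideanSpace ℂ (Fin n) :=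
  WithLp.toLp 2 (∑ j, x j • c j)

lemma map_gaussianColumns_succ (n k : ℕ) :
    (gaussianColumns n (k + 1)).map (fun p => (p 0, Fin.tail p)) =
      (complexGaussianPi (Fin n)).prod (gaussianColumns n k) :=
  (measurePreserving_piFinSuccAbove (fun _ : Fin (k + 1) => complexGaussianPi (Fin n)) 0).map_eq

lemma gaussianColumns_succ_apply {n k : ℕ} {s : Set ((Fin n → ℂ) × (Fin k → Fin n → ℂ))}
    (hs : MeasurableSet s) :
    gaussianColumns n (k + 1) {p | (p 0, Fin.tail p) ∈ s} =
      ∫⁻ c, complexGaussianPi (Fin n) {g | (g, c) ∈ s} ∂(gaussianColumns n k) := by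
  have hm : Measurable fun p : Fin (k + 1) → Fin n → ℂ => (p 0, Fin.tail p) :=
    (measurable_pi_apply 0).prodMk (measurable_pi_lambda _ fun j => measurable_pi_apply _)
  change gaussianColumns n (k + 1) ((fun p => (p 0, Fin.tail p)) ⁻¹' s) = _
  rw [← Measure.map_apply hm hs, map_gaussianColumns_succ, Measure.prod_apply_symm hs]
  rfl

/-- The span is orthogonal to some unit vector, so it lies in a slab of width zero. -/
lemma complexGaussianPi_span_eq_zero {n k : ℕ} (hk : k < n) (c : Fin k → Fin n → ℂ) :
    complexGaussianPi (Fin n) {g | g ∈ Submodule.span ℂ (Set.range c)} = 0 := by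
  set W : Submodule ℂ (EuclideanSpace ℂ (Fin n)) :=
    Submodule.span ℂ (Set.range fun j => WithLp.toLp 2 (c j)) with hW
  have hWtop : W ≠ ⊤ := by
    intro h
    have h1 : Module.finrank ℂ W ≤ k := by
      simpa using! finrank_range_le_card (R := ℂ) (fun j => WithLp.toLp 2 (c j))
    rw [h, finrank_top, finrank_euclideanSpace, Fintype.card_fin] at h1
    omega
  have hWo : Wᗮ ≠ ⊥ := fun h => hWtop (by
    have := W.orthogonal_orthogonal
    rw [h, Submodule.bot_orthogonal_eq_top] at this
    exact this.symm)
  obtain ⟨w, hw, hw0⟩ := Submodule.exists_mem_ne_zero_of_ne_bot hWo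
  have hn : ‖w‖ ≠ 0 := norm_ne_zero_iff.2 hw0
  set e : Fin 1 → EuclideanSpace ℂ (Fin n) := fun _ => ((‖w‖⁻¹ : ℝ) : ℂ) • w with he
  have hor : Orthonormal ℂ e := by
    refine ⟨fun i => ?_, fun i j hij => (hij (Subsingleton.elim i j)).elim⟩
    simp [he, norm_smul, hn]
  refine nonpos_iff_eq_zero.1 ?_
  calc _ ≤ complexGaussianPi (Fin n) {g | ∀ i, ‖inner ℂ (e i) (WithLp.toLp 2 g)‖ ≤ 0} := by
        refine measure_mono fun g hg i => ?_
        have hgW : WithLp.toLp 2 g ∈ W := by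
          have : Submodule.span ℂ (Set.range c) ≤
              W.comap (WithLp.linearEquiv 2 ℂ (Fin n → ℂ)).symm.toLinearMap := by
            rw [Submodule.span_le]
            rintro _ ⟨j, rfl⟩
            exact Submodule.subset_span ⟨j, rfl⟩
          exact this hg
        have : inner ℂ w (WithLp.toLp 2 g) = 0 := Submodule.inner_left_of_mem_orthogonal hgW hw
        simp [he, this]
    _ ≤ ENNReal.ofReal (2 * 0) ^ (2 * 1) := complexGaussianPi_slab_le e hor 0
    _ = 0 := by simp

/-- At most `n` independent Gaussian vectors of length `n` are almost surely linearly
independent. -/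
lemma gaussianColumns_not_linearIndependent {n k : ℕ} (hk : k ≤ n) :
    gaussianColumns n k {c | ¬ LinearIndependent ℂ c} = 0 := by
  induction k with
  | zero =>
    have : {c : Fin 0 → Fin n → ℂ | ¬ LinearIndependent ℂ c} = ∅ := by
      ext c
      simp
    rw [this, measure_empty]
  | succ k ih =>
    have hcont : Continuous fun q : (Fin n → ℂ) × (Fin k → Fin n → ℂ) =>
        (Fin.cons q.1 q.2 : Fin (k + 1) → Fin n → ℂ) := by
      refine continuous_pi fun j => ?_
      refine Fin.cases ?_ (fun j => ?_) j
      · simpa using continuous_fst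
      · simp only [Fin.cons_succ]
        fun_prop
    have hms : MeasurableSet {q : (Fin n → ℂ) × (Fin k → Fin n → ℂ) |
        ¬ LinearIndependent ℂ (Fin.cons q.1 q.2 : Fin (k + 1) → Fin n → ℂ)} :=
      ((isOpen_setOfPred_linearIndependent (𝕜 := ℂ)).preimage hcont).measurableSet.compl
    have hset : {c : Fin (k + 1) → Fin n → ℂ | ¬ LinearIndependent ℂ c} =
        {p | ((p 0, Fin.tail p) : (Fin n → ℂ) × (Fin k → Fin n → ℂ)) ∈ {q : (Fin n → ℂ) × (Fin k → Fin n → ℂ) |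
          ¬ LinearIndependent ℂ (Fin.cons q.1 q.2 : Fin (k + 1) → Fin n → ℂ)}} := by
      ext c
      simp
    rw [hset, gaussianColumns_succ_apply hms]
    refine (lintegral_congr_ae ?_).trans lintegral_zero
    have hae : ∀ᵐ c ∂(gaussianColumns n k), LinearIndependent ℂ c := by
      rw [ae_iff]; exact ih (by omega)
    filter_upwards [hae] with c hc
    refine measure_mono_null (fun g hg => ?_) (complexGaussianPi_span_eq_zero (by omega) c)
    by_contra hgc
    exact hg (linearIndependent_finCons.2 ⟨hc, hgc⟩)

/-- Given linearly independent columns, the projection of a Gaussian vector on their span is short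
with small probability. -/
lemma complexGaussianPi_projection_le {n k : ℕ} {c : Fin k → Fin n → ℂ}
    (hc : LinearIndependent ℂ c) (t : ℝ) :
    complexGaussianPi (Fin n) {g | ∀ x, ‖inner ℂ (colComb c x) (WithLp.toLp 2 g)‖ ≤
      t * ‖colComb c x‖} ≤ ENNReal.ofReal (2 * t) ^ (2 * k) := by
  set b : Fin k → EuclideanSpace ℂ (Fin n) := fun j => WithLp.toLp 2 (c j) with hb
  have hbi : LinearIndependent ℂ b :=
    hc.map' (WithLp.linearEquiv 2 ℂ (Fin n → ℂ)).symm.toLinearMap (LinearEquiv.ker _)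
  have hfr : Module.finrank ℂ (Submodule.span ℂ (Set.range b)) = k := by
    rw [finrank_span_eq_card hbi, Fintype.card_fin]
  set B := (stdOrthonormalBasis ℂ (Submodule.span ℂ (Set.range b))).reindex (finCongr hfr) with hB
  have hor : Orthonormal ℂ fun i => (B i : EuclideanSpace ℂ (Fin n)) :=
    B.orthonormal.comp_linearIsometry (Submodule.subtypeₗᵢ _)
  -- Each basis vector is itself a combination `colComb c x`, of norm one, so the hypothesis bounds
  -- every coordinate by `t`.
  refine (measure_mono fun g hg i => ?_).trans (complexGaussianPi_slab_le _ hor t)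
  obtain ⟨x, hx⟩ := (Submodule.mem_span_range_iff_exists_fun ℂ).1 (B i).2
  have hx' : colComb c x = B i := by
    rw [← hx, colComb]
    simp [hb]
  have := hg x
  rw [hx', hor.1 i, mul_one] at this
  exact this

/-- The first column `p 0` is short in the direction of the span of the others, relative to their
size, or the others are linearly dependent. -/
def shortProjection (n k : ℕ) (t : ℝ) : Set (Fin (k + 1) → Fin n → ℂ) :=
  {p | ¬ LinearIndependent ℂ (Fin.tail p) ∨
    ∀ x, ‖inner ℂ (colComb (Fin.tail p) x) (WithLp.toLp 2 (p 0))‖ ≤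
      t * ‖Fin.tail p‖ * ‖colComb (Fin.tail p) x‖}

/-- Pairing with every combination, instead of naming the orthogonal projection, gives an
intersection of closed conditions even where the columns become dependent. -/
lemma isClosed_projection (n k : ℕ) (t : ℝ) :
    IsClosed {q : (Fin n → ℂ) × (Fin k → Fin n → ℂ) |
      ∀ x, ‖inner ℂ (colComb q.2 x) (WithLp.toLp 2 q.1)‖ ≤ t * ‖q.2‖ * ‖colComb q.2 x‖} := by
  simp only [Set.ofPred_forall]
  refine isClosed_iInter fun x => ?_
  have h1 : Continuous fun q : (Fin n → ℂ) × (Fin k → Fin n → ℂ) => colComb q.2 x := by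
    unfold colComb
    exact (PiLp.continuous_toLp 2 _).comp (by fun_prop)
  have h2 : Continuous fun q : (Fin n → ℂ) × (Fin k → Fin n → ℂ) => WithLp.toLp 2 q.1 :=
    (PiLp.continuous_toLp 2 _).comp continuous_fst
  exact isClosed_le (h1.inner h2).norm (by fun_prop)

lemma shortProjection_eq (n k : ℕ) (t : ℝ) :
    shortProjection n k t = {p | ((p 0, Fin.tail p) : (Fin n → ℂ) × (Fin k → Fin n → ℂ)) ∈
      {q : (Fin n → ℂ) × (Fin k → Fin n → ℂ) | ¬ LinearIndependent ℂ q.2 ∨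
        ∀ x, ‖inner ℂ (colComb q.2 x) (WithLp.toLp 2 q.1)‖ ≤ t * ‖q.2‖ * ‖colComb q.2 x‖}} := rfl

lemma measurableSet_linearDependent_or_projection (n k : ℕ) (t : ℝ) :
    MeasurableSet {q : (Fin n → ℂ) × (Fin k → Fin n → ℂ) | ¬ LinearIndependent ℂ q.2 ∨
        ∀ x, ‖inner ℂ (colComb q.2 x) (WithLp.toLp 2 q.1)‖ ≤ t * ‖q.2‖ * ‖colComb q.2 x‖} :=
  ((isOpen_setOfPred_linearIndependent (𝕜 := ℂ)).preimage continuous_snd).measurableSet.compl.union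
    (isClosed_projection n k t).measurableSet

lemma measurableSet_shortProjection (n k : ℕ) (t : ℝ) :
    MeasurableSet (shortProjection n k t) := by
  have hm : Measurable fun p : Fin (k + 1) → Fin n → ℂ => (p 0, Fin.tail p) :=
    (measurable_pi_apply 0).prodMk (measurable_pi_lambda _ fun j => measurable_pi_apply _)
  exact hm (measurableSet_linearDependent_or_projection n k t)

/-- Makes the joint law of the columns Gaussian, hence with finite moments of every order. -/
instance isGaussian_pi {ι : Type*} [Fintype ι] {E : ι → Type*} [∀ i, NormedAddCommGroup (E i)]
    [∀ i, NormedSpace ℝ (E i)] [∀ i, MeasurableSpace (E i)] [∀ i, BorelSpace (E i)]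
    [∀ i, SecondCountableTopology (E i)] [∀ i, CompleteSpace (E i)]
    (μ : ∀ i, Measure (E i)) [∀ i, IsGaussian (μ i)] : IsGaussian (Measure.pi μ) := by
  have h := (iIndepFun_pi (μ := μ) (X := fun i => (id : E i → E i))
    fun i => aemeasurable_id).hasGaussianLaw fun i => ⟨by
      change IsGaussian ((Measure.pi μ).map (fun p => p i))
      rw [(measurePreserving_eval μ i).map_eq]
      infer_instance⟩
  have h' := h.isGaussian_map
  change IsGaussian ((Measure.pi μ).map id) at h'
  rwa [Measure.map_id] at h'

instance isGaussian_complexGaussianPi (ι : Type*) [Fintype ι] : IsGaussian (complexGaussianPi ι) :=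
  isGaussian_pi _

instance isGaussian_gaussianColumns (n k : ℕ) : IsGaussian (gaussianColumns n k) :=
  isGaussian_pi _

/-- A Gaussian moment of the columns. -/
def columnMoment (n k : ℕ) : ℝ≥0∞ :=
  ∫⁻ c, ‖c‖ₑ ^ (2 * k) ∂(gaussianColumns n k)

lemma columnMoment_lt_top (n k : ℕ) : columnMoment n k < ∞ := by
  unfold columnMoment
  rcases Nat.eq_zero_or_pos k with rfl | hk
  · simp
  have h := (IsGaussian.memLp_id (gaussianColumns n k) ((2 * k : ℕ) : ℝ≥0∞)
    (ENNReal.natCast_ne_top (2 * k))).2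
  have h2 := (eLpNorm_lt_top_iff_lintegral_rpow_enorm_lt_top
    (p := ((2 * k : ℕ) : ℝ≥0∞)) (by simp; omega) (ENNReal.natCast_ne_top (2 * k))).1 h
  simpa [-Nat.cast_mul] using h2

/-- Conditionally on the other columns `c`, the threshold `t * ‖c‖` is a constant; integrating its
power over `c` produces the moment. -/
lemma gaussianColumns_shortProjection_le {n k : ℕ} (hk : k ≤ n) {t : ℝ} (ht : 0 ≤ t) :
    gaussianColumns n (k + 1) (shortProjection n k t) ≤
      ENNReal.ofReal (2 * t) ^ (2 * k) * columnMoment n k := by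
  rw [shortProjection_eq, gaussianColumns_succ_apply
    (measurableSet_linearDependent_or_projection n k t), columnMoment,
    ← lintegral_const_mul _ (by fun_prop)]
  have hae : ∀ᵐ c ∂(gaussianColumns n k), LinearIndependent ℂ c := by
    rw [ae_iff]; exact gaussianColumns_not_linearIndependent hk
  refine lintegral_mono_ae ?_
  filter_upwards [hae] with c hc
  calc _ ≤ complexGaussianPi (Fin n) {g | ∀ x, ‖inner ℂ (colComb c x) (WithLp.toLp 2 g)‖ ≤
      (t * ‖c‖) * ‖colComb c x‖} :=
        measure_mono fun g hg => hg.resolve_left (not_not.2 hc)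
    _ ≤ ENNReal.ofReal (2 * (t * ‖c‖)) ^ (2 * k) := complexGaussianPi_projection_le hc _
    _ = _ := by
        rw [← mul_assoc, ENNReal.ofReal_mul (by positivity), mul_pow, ofReal_norm]

/-! ### Deterministic geometry: lattice points near a multiple of a vector. -/

section Columns

variable {n k : ℕ}

lemma colComb_add (c : Fin k → Fin n → ℂ) (x y : Fin k → ℂ) :
    colComb c (x + y) = colComb c x + colComb c y := by
  simp [colComb, add_smul, Finset.sum_add_distrib]

lemma colComb_smul (c : Fin k → Fin n → ℂ) (a : ℂ) (x : Fin k → ℂ) :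
    colComb c (a • x) = a • colComb c x := by
  simp [colComb, mul_smul, Finset.smul_sum]

/-- `colComb` as a linear map in the coefficients. -/
def colCombₗ (c : Fin k → Fin n → ℂ) : (Fin k → ℂ) →ₗ[ℂ] EuclideanSpace ℂ (Fin n) where
  toFun := colComb c
  map_add' := colComb_add c
  map_smul' := colComb_smul c

lemma colCombₗ_apply (c : Fin k → Fin n → ℂ) (x : Fin k → ℂ) : colCombₗ c x = colComb c x := rfl

lemma colComb_sub (c : Fin k → Fin n → ℂ) (x y : Fin k → ℂ) :
    colComb c (x - y) = colComb c x - colComb c y := map_sub (colCombₗ c) x y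

lemma colComb_injective {c : Fin k → Fin n → ℂ} (hc : LinearIndependent ℂ c) :
    Function.Injective (colComb c) := by
  intro x y hxy
  have h := WithLp.toLp_injective 2 hxy
  exact (linearIndependent_iff_injective_fintypeLinearCombination.1 hc) (by simpa [Fintype.linearCombination_apply])

lemma norm_toLp_le (z : Fin n → ℂ) : ‖(WithLp.toLp 2 z : EuclideanSpace ℂ (Fin n))‖ ≤ n * ‖z‖ := by
  refine abs_le_of_sq_le_sq' ?_ (by positivity) |>.2
  rw [EuclideanSpace.norm_sq_eq]
  calc ∑ i, ‖z i‖ ^ 2 ≤ ∑ _i : Fin n, ‖z‖ ^ 2 :=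
        Finset.sum_le_sum fun i _ => by gcongr; exact norm_le_pi_norm z i
    _ = n * ‖z‖ ^ 2 := by simp
    _ ≤ (n * ‖z‖) ^ 2 := by
        rw [mul_pow]
        gcongr
        exact_mod_cast Nat.le_self_pow two_ne_zero n

lemma norm_colComb_le (c : Fin k → Fin n → ℂ) (x : Fin k → ℂ) :
    ‖colComb c x‖ ≤ n * (k * (‖x‖ * ‖c‖)) := by
  refine (norm_toLp_le _).trans ?_
  gcongr
  calc ‖∑ j, x j • c j‖ ≤ ∑ j, ‖x j • c j‖ := norm_sum_le _ _
    _ ≤ ∑ _j : Fin k, ‖x‖ * ‖c‖ := Finset.sum_le_sum fun j _ => by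
        rw [norm_smul]
        gcongr
        · exact norm_le_pi_norm x j
        · exact norm_le_pi_norm c j
    _ = _ := by simp

lemma exists_gaussianInt_near (z : ℂ) : ∃ q : GaussianInt, ‖GaussianInt.toComplex q - z‖ ≤ 1 := by
  refine ⟨⟨round z.re, round z.im⟩, (Complex.norm_le_abs_re_add_abs_im _).trans ?_⟩
  have h1 := abs_sub_round z.re
  have h2 := abs_sub_round z.im
  rw [abs_sub_comm] at h1 h2
  simp only [Complex.sub_re, Complex.sub_im, GaussianInt.re_toComplex, GaussianInt.im_toComplex]
  linarith

/-- A point has a best approximation by combinations of the columns, whose residual is orthogonal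
to all of them. -/
lemma exists_colComb_projection (c : Fin k → Fin n → ℂ) (z : EuclideanSpace ℂ (Fin n)) :
    ∃ x₀, ∀ x, inner ℂ (colComb c x) (z - colComb c x₀) = 0 := by
  set W := LinearMap.range (colCombₗ c)
  obtain ⟨x₀, hx₀⟩ := LinearMap.mem_range.1 (W.starProjection_apply_mem z)
  refine ⟨x₀, fun x => ?_⟩
  rw [← colCombₗ_apply c x₀, hx₀]
  exact Submodule.inner_right_of_mem_orthogonal (LinearMap.mem_range_self _ x)
    (W.sub_starProjection_mem_orthogonal z)

/-- If the projection of `g` on the span of the columns is long, then every ball about a short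
multiple of `g` contains many lattice points. -/
lemma exists_many_near {c : Fin k → Fin n → ℂ} (hk : 0 < k) (d : ℕ)
    {g : EuclideanSpace ℂ (Fin n)} {a : ℂ} {s : ℝ} (has : ‖a‖ ≤ s)
    (hg : ∃ x, ((n * (k * (1 + d)) : ℕ) : ℝ) * ‖c‖ * ‖colComb c x‖ <
      s * ‖inner ℂ (colComb c x) g‖) :
    ∃ f : Fin d → Fin k → GaussianInt, Function.Injective f ∧
      ∀ j, ‖colComb c (fun i => GaussianInt.toComplex (f j i)) - a • g‖ ≤ s * ‖g‖ := by
  obtain ⟨x₀, hx₀⟩ := exists_colComb_projection c g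
  set P := colComb c x₀ with hP
  have hs : 0 ≤ s := (norm_nonneg a).trans has
  -- Pairings with `g` see only `P`, so Cauchy–Schwarz turns one large pairing into a lower bound on
  -- `‖P‖`.
  have hPlong : ((n * (k * (1 + d)) : ℕ) : ℝ) * ‖c‖ ≤ s * ‖P‖ := by
    obtain ⟨x, hx⟩ := hg
    have h1 : inner ℂ (colComb c x) g = inner ℂ (colComb c x) P := by
      have := hx₀ x
      rwa [inner_sub_right, sub_eq_zero] at this
    rw [h1] at hx
    by_contra! hlt
    have h2 := norm_inner_le_norm (𝕜 := ℂ) (colComb c x) P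
    have h3 : s * ‖inner ℂ (colComb c x) P‖ ≤ s * ‖P‖ * ‖colComb c x‖ := by
      calc _ ≤ s * (‖colComb c x‖ * ‖P‖) := by gcongr
        _ = _ := by ring
    have h4 : s * ‖P‖ * ‖colComb c x‖ ≤ (n * (k * (1 + d)) : ℕ) * ‖c‖ * ‖colComb c x‖ := by
      gcongr
    linarith
  have hpyth : ∀ (x : Fin k → ℂ) (b : ℂ), ‖colComb c x - b • g‖ ^ 2 = ‖colComb c x - b • P‖ ^ 2 +
      ‖b‖ ^ 2 * ‖g - P‖ ^ 2 := by
    intro x b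
    have h : inner ℂ (colComb c x - b • P) (-(b • (g - P))) = 0 := by
      rw [hP, ← colComb_smul, ← colComb_sub, inner_neg_right, inner_smul_right, hx₀]
      simp
    have h2 := norm_add_sq_eq_norm_sq_add_norm_sq_of_inner_eq_zero _ _ h
    rw [norm_neg, norm_smul] at h2
    rw [show colComb c x - b • g = colComb c x - b • P + -(b • (g - P)) by
      rw [smul_sub]; abel]
    linarith [h2, mul_pow ‖b‖ ‖g - P‖ 2]
  choose q hq using fun i => exists_gaussianInt_near ((a • x₀) i)
  set i₀ : Fin k := ⟨0, hk⟩
  -- Rounding moves each coordinate by at most `1` and the shift by less than `d`, whence the factor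
  -- `1 + d`.
  refine ⟨fun j i => q i + if i = i₀ then ((j : ℕ) : GaussianInt) else 0, ?_, ?_⟩
  · intro j j' h
    have := congr_fun h i₀
    simp only [if_true, add_right_inj, Nat.cast_inj] at this
    exact Fin.ext this
  · intro j
    set w : Fin k → ℂ := fun i => GaussianInt.toComplex
      (q i + if i = i₀ then ((j : ℕ) : GaussianInt) else 0) with hw
    have hwn : ‖w - a • x₀‖ ≤ 1 + d := by
      refine (pi_norm_le_iff_of_nonneg (by positivity)).2 fun i => ?_
      have h1 : (w - a • x₀) i = (GaussianInt.toComplex (q i) - (a • x₀) i) +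
          (if i = i₀ then ((j : ℕ) : ℂ) else 0) := by
        simp only [hw, Pi.sub_apply, map_add]
        split_ifs <;> simp <;> ring
      rw [h1]
      refine (norm_add_le _ _).trans (add_le_add (hq i) ?_)
      split_ifs
      · rw [Complex.norm_natCast]
        exact_mod_cast j.2.le
      · simp
    have hclose : ‖colComb c w - a • P‖ ≤ s * ‖P‖ := by
      rw [hP, ← colComb_smul, ← colComb_sub]
      refine (norm_colComb_le c _).trans (le_trans ?_ hPlong)
      push_cast
      calc (n : ℝ) * (k * (‖w - a • x₀‖ * ‖c‖)) ≤ n * (k * ((1 + d) * ‖c‖)) := by gcongr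
        _ = _ := by ring
    refine abs_le_of_sq_le_sq' ?_ (by positivity) |>.2
    -- This is `‖g‖² = ‖P‖² + ‖g - P‖²`; the two components are then compared separately.
    have h0 := hpyth 0 1
    have hz : colComb c 0 = 0 := map_zero (colCombₗ c)
    simp only [hz, one_smul, zero_sub, norm_neg, norm_one, one_pow, one_mul] at h0
    rw [hpyth, mul_pow, h0, mul_add, ← mul_pow s ‖P‖]
    gcongr

end Columns

/-! ### Candidate messages, finiteness of balls and the key index. -/

section Eve

variable {NE NB m : ℕ}

/-- The columns of a matrix. -/
abbrev columns (A : Matrix (Fin NE) (Fin NB) ℂ) : Fin NB → Fin NE → ℂ := fun j i => A i j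

lemma latticePoint_eq (A : Matrix (Fin NE) (Fin NB) ℂ) (u : Fin NB → GaussianInt) :
    latticePoint A u = colComb (columns A) fun i => GaussianInt.toComplex (u i) := by
  unfold latticePoint colComb
  congr 1
  ext i
  simp [Matrix.mulVec, dotProduct, mul_comm]

lemma latticePoint_injective {A : Matrix (Fin NE) (Fin NB) ℂ}
    (hA : LinearIndependent ℂ (columns A)) : Function.Injective (latticePoint A) := by
  intro u w h
  rw [latticePoint_eq, latticePoint_eq] at h
  funext i
  exact GaussianInt.toComplex_injective (congr_fun (colComb_injective hA h) i)

lemma noisePoint_smul (B : Matrix (Fin NE) (Fin m) ℂ) (a : ℂ) (v : EuclideanSpace ℂ (Fin m)) :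
    noisePoint B (a • v) = a • noisePoint B v := by
  simp [noisePoint, Matrix.mulVec_smul]

lemma norm_noisePoint_le_maxRadius (B : Matrix (Fin NE) (Fin m) ℂ) {Pv : ℝ}
    {v : EuclideanSpace ℂ (Fin m)} (hv : ‖v‖ ^ 2 ≤ Pv) : ‖noisePoint B v‖ ≤ maxRadius B Pv := by
  refine le_csSup ?_ ⟨v, hv, rfl⟩
  have hcont : Continuous fun v : EuclideanSpace ℂ (Fin m) => ‖noisePoint B v‖ := by
    unfold noisePoint
    exact ((PiLp.continuous_toLp 2 _).comp (Continuous.matrix_mulVec continuous_const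
      (PiLp.continuous_ofLp 2 _))).norm
  refine ((isCompact_closedBall (0 : EuclideanSpace ℂ (Fin m)) (√Pv)).image hcont).bddAbove.mono
    (Set.image_mono fun w hw => ?_)
  rw [mem_closedBall_zero_iff]
  exact Real.le_sqrt_of_sq_le hw

/-- If the noise image of the unit vector `e` has a long projection on the span of the lattice,
there are `d` candidate messages. -/
lemma exists_candidates {A : Matrix (Fin NE) (Fin NB) ℂ} {B : Matrix (Fin NE) (Fin m) ℂ}
    (hNB : 0 < NB) (d : ℕ) {Pv : ℝ} (hPv : 0 < Pv) {e v : EuclideanSpace ℂ (Fin m)}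
    (he : ‖e‖ = 1) (hve : v = (‖v‖ : ℂ) • e) (hv : ‖v‖ ^ 2 ≤ Pv)
    (hg : ∃ x, ((NE * (NB * (1 + d)) : ℕ) : ℝ) / √Pv * ‖columns A‖ * ‖colComb (columns A) x‖ <
      ‖inner ℂ (colComb (columns A) x) (noisePoint B e)‖) (u : Fin NB → GaussianInt) :
    ∃ f : Fin d → Fin NB → GaussianInt, Function.Injective f ∧
      ∀ j, f j ∈ candidates A B Pv (received A B u v) := by
  have hs : 0 < √Pv := Real.sqrt_pos.2 hPv
  obtain ⟨f, hf, hfd⟩ := exists_many_near (c := columns A) hNB d (g := noisePoint B e)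
    (a := (‖v‖ : ℂ)) (s := √Pv) (by simpa using Real.le_sqrt_of_sq_le hv) (by
      obtain ⟨x, hx⟩ := hg
      refine ⟨x, ?_⟩
      have := mul_lt_mul_of_pos_left hx hs
      refine lt_of_eq_of_lt ?_ this
      field_simp)
  -- The lattice is translation invariant, so points near `‖v‖ • noisePoint B e` become points near
  -- `y` after adding `A u`.
  refine ⟨fun j => u + f j, fun j j' h => hf (add_left_cancel h), fun j => ?_⟩
  have hR : √Pv * ‖noisePoint B e‖ ≤ maxRadius B Pv := by
    have := norm_noisePoint_le_maxRadius B (v := ((√Pv : ℝ) : ℂ) • e) (Pv := Pv) (by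
      rw [norm_smul, he, mul_one, Complex.norm_real, Real.norm_of_nonneg hs.le,
        Real.sq_sqrt hPv.le])
    rwa [noisePoint_smul, norm_smul, Complex.norm_real, Real.norm_of_nonneg hs.le] at this
  change latticePoint A (u + f j) ∈ Metric.closedBall _ _
  rw [Metric.mem_closedBall, dist_eq_norm]
  refine le_trans (le_of_eq ?_) ((hfd j).trans hR)
  have h1 : latticePoint A (u + f j) = latticePoint A u + latticePoint A (f j) := by
    rw [latticePoint_eq, latticePoint_eq, latticePoint_eq, ← colComb_add]
    congr 1
    ext i
    simp
  rw [h1, received, ← noisePoint_smul, ← hve, ← latticePoint_eq]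
  congr 1
  abel

lemma le_keySpaceSize {A : Matrix (Fin NE) (Fin NB) ℂ} {B : Matrix (Fin NE) (Fin m) ℂ}
    (hA : LinearIndependent ℂ (columns A)) {Pv : ℝ} {y : EuclideanSpace ℂ (Fin NE)} {d : ℕ}
    {f : Fin d → Fin NB → GaussianInt} (hf : Function.Injective f)
    (hfc : ∀ j, f j ∈ candidates A B Pv y) : (d : ℕ∞) ≤ keySpaceSize A B Pv y := by
  have h1 : (d : ℕ∞) ≤ (Set.range (latticePoint A ∘ f)).encard := by
    simpa using ((latticePoint_injective hA).comp hf).encard_range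
  refine h1.trans (Set.encard_le_encard ?_)
  rintro _ ⟨j, rfl⟩
  exact ⟨hfc j, ⟨f j, rfl⟩⟩

lemma finite_gaussianInt_norm_le (R : ℝ) : {q : GaussianInt | ‖GaussianInt.toComplex q‖ ≤ R}.Finite := by
  have hfin : (Set.Icc (-⌈R⌉) ⌈R⌉ ×ˢ Set.Icc (-⌈R⌉) ⌈R⌉).Finite :=
    (Set.finite_Icc _ _).prod (Set.finite_Icc _ _)
  refine Set.Finite.of_injOn (f := fun q : GaussianInt => (q.re, q.im)) ?_ ?_ hfin
  · intro q hq
    have h1 := (Complex.abs_re_le_norm _).trans hq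
    have h2 := (Complex.abs_im_le_norm _).trans hq
    rw [← GaussianInt.intCast_re] at h1
    rw [← GaussianInt.intCast_im] at h2
    have hR := Int.le_ceil R
    have key : ∀ z : ℤ, |(z : ℝ)| ≤ R → z ∈ Set.Icc (-⌈R⌉) ⌈R⌉ := by
      intro z hz
      have : |z| ≤ ⌈R⌉ := by
        have := hz.trans hR
        exact_mod_cast this
      exact abs_le.1 this
    exact ⟨key _ h1, key _ h2⟩
  · intro q _ q' _ h
    exact Zsqrtd.ext (congr_arg Prod.fst h) (congr_arg Prod.snd h)

/-- An injective linear map in finite dimension is antilipschitz, so a bounded set of lattice points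
has bounded integer coefficients. -/
lemma finite_dist_latticePoint_le {A : Matrix (Fin NE) (Fin NB) ℂ}
    (hA : LinearIndependent ℂ (columns A)) (y : EuclideanSpace ℂ (Fin NE)) (r : ℝ) :
    {w | dist (latticePoint A w) y ≤ r}.Finite := by
  obtain ⟨K, -, hK⟩ := (colCombₗ (columns A)).exists_antilipschitzWith
    (LinearMap.ker_eq_bot.2 (colComb_injective hA))
  refine Set.Finite.subset (Set.Finite.pi' fun _ : Fin NB =>
    finite_gaussianInt_norm_le (K * (r + ‖y‖))) fun w hw i => ?_
  have h1 := hK.le_mul_dist (fun i => GaussianInt.toComplex (w i)) 0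
  rw [map_zero, dist_zero_right, dist_zero_right, colCombₗ_apply, ← latticePoint_eq] at h1
  have h2 : ‖latticePoint A w‖ ≤ r + ‖y‖ := by
    have hw' : dist (latticePoint A w) y ≤ r := hw
    rw [dist_eq_norm] at hw'
    linarith [norm_le_norm_sub_add (latticePoint A w) y]
  refine (norm_le_pi_norm (fun i => GaussianInt.toComplex (w i)) i).trans (h1.trans ?_)
  gcongr

lemma keyIndex_injective {A : Matrix (Fin NE) (Fin NB) ℂ}
    (hA : LinearIndependent ℂ (columns A)) (y : EuclideanSpace ℂ (Fin NE))
    {τ : (Fin NB → GaussianInt) → ℕ} (hτ : Function.Injective τ) :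
    Function.Injective (keyIndex τ A y) := by
  have hlt : ∀ u w : Fin NB → GaussianInt, (dist (latticePoint A u) y < dist (latticePoint A w) y ∨
      (dist (latticePoint A u) y = dist (latticePoint A w) y ∧ τ u < τ w)) →
      keyIndex τ A y u < keyIndex τ A y w := by
    intro u w h
    -- Initial segments of the lexicographic order (distance, `τ`) are strictly nested. Finiteness
    -- is essential, as `ncard` is `0` on infinite sets.
    refine Nat.add_lt_add_left (Set.ncard_lt_ncard ?_ ?_) 1
    · refine (Set.ssubset_iff_of_subset ?_).2 ⟨u, h, ?_⟩
      · rintro x (hx | ⟨hx, hx'⟩) <;> rcases h with h | ⟨h, h'⟩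
        · exact Or.inl (hx.trans h)
        · exact Or.inl (h ▸ hx)
        · exact Or.inl (hx ▸ h)
        · exact Or.inr ⟨hx.trans h, hx'.trans h'⟩
      · rintro (hx | ⟨-, hx⟩) <;> exact lt_irrefl _ hx
    · refine (finite_dist_latticePoint_le hA y (dist (latticePoint A w) y)).subset ?_
      rintro x (hx | ⟨hx, -⟩)
      · exact hx.le
      · exact hx.le
  intro u w h
  by_contra hne
  rcases lt_trichotomy (dist (latticePoint A u) y) (dist (latticePoint A w) y) with h1 | h1 | h1
  · exact (hlt u w (Or.inl h1)).ne h
  · rcases lt_or_gt_of_ne (hτ.ne hne) with h2 | h2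
    · exact (hlt u w (Or.inr ⟨h1, h2⟩)).ne h
    · exact (hlt w u (Or.inr ⟨h1.symm, h2⟩)).ne h.symm
  · exact (hlt w u (Or.inl h1)).ne h.symm

end Eve

/-! ### Nonvanishing entropy of the posterior laws. -/

/-- All terms are nonnegative, and one mass strictly between `0` and `1` already contributes a
positive term. -/
lemma entropy_ne_zero {α : Type*} {p : α → ℝ≥0∞} {a : α} (h0 : p a ≠ 0) (h1 : p a < 1) :
    entropy p ≠ 0 := by
  intro h
  have ha := ENNReal.tsum_eq_zero.1 h a
  rw [ENNReal.ofReal_eq_zero] at ha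
  have hpos : 0 < (p a).toReal := ENNReal.toReal_pos h0 (h1.trans ENNReal.one_lt_top).ne
  have hlt : (p a).toReal < 1 := by
    have := (ENNReal.toReal_lt_toReal (h1.trans ENNReal.one_lt_top).ne ENNReal.one_ne_top).2 h1
    simpa using this
  have := mul_pos hpos (neg_pos.2 (Real.log_neg hpos hlt))
  rw [Real.negMulLog] at ha
  linarith

lemma conditioned_ne_zero {α : Type*} {p : α → ℝ≥0∞} (hp : ∑' a, p a ≠ ∞)
    {s : Set α} {a : α} (ha : a ∈ s) (hpa : p a ≠ 0) : conditioned p s a ≠ 0 := by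
  rw [conditioned, if_pos ha]
  refine (ENNReal.div_pos hpa (ne_top_of_le_ne_top hp ?_)).ne'
  exact ENNReal.tsum_comp_le_tsum_of_injective Subtype.val_injective p

lemma conditioned_lt_one {α : Type*} {p : α → ℝ≥0∞} (hp : ∑' a, p a ≠ ∞)
    {s : Set α} {a b : α} (ha : a ∈ s) (hb : b ∈ s) (hab : a ≠ b) (hpb : p b ≠ 0) :
    conditioned p s a < 1 := by
  classical
  have hle : p a + p b ≤ ∑' x : s, p x := by
    have h := ENNReal.sum_le_tsum (f := fun x : s => p x) {⟨a, ha⟩, ⟨b, hb⟩}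
    rwa [Finset.sum_pair (by simpa using hab)] at h
  have hpa : p a ≠ ∞ := ne_top_of_le_ne_top hp (ENNReal.le_tsum a)
  have hlt : p a < ∑' x : s, p x := (ENNReal.lt_add_right hpa hpb).trans_le hle
  rw [conditioned, if_pos ha]
  refine ENNReal.div_lt_of_lt_mul ?_
  rwa [one_mul]

lemma pushforward_apply_of_injective {α β : Type*} {f : α → β} (hf : Function.Injective f)
    (p : α → ℝ≥0∞) (a : α) : pushforward f p (f a) = p a := by
  rw [pushforward, tsum_eq_single a]
  · simp
  · intro b hb
    rw [if_neg (hf.ne hb)]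

lemma idealSecrecy_of_candidates {NE NB m : ℕ} {τ : (Fin NB → GaussianInt) → ℕ}
    (hτ : Function.Injective τ) {p : (Fin NB → GaussianInt) → ℝ≥0∞} (hp0 : ∀ w, p w ≠ 0)
    (hp : ∑' w, p w ≠ ∞) {A : Matrix (Fin NE) (Fin NB) ℂ} {B : Matrix (Fin NE) (Fin m) ℂ}
    (hA : LinearIndependent ℂ (columns A)) {Pv : ℝ} {y : EuclideanSpace ℂ (Fin NE)}
    {a b : Fin NB → GaussianInt} (ha : a ∈ candidates A B Pv y) (hb : b ∈ candidates A B Pv y)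
    (hab : a ≠ b) : IdealSecrecy τ p A B Pv y := by
  have h0 := conditioned_ne_zero hp ha (hp0 a)
  have h1 := conditioned_lt_one hp ha hb hab (hp0 b)
  refine ⟨entropy_ne_zero h0 h1, ?_⟩
  have hpush := pushforward_apply_of_injective (keyIndex_injective hA y hτ)
    (conditioned p (candidates A B Pv y)) a
  exact entropy_ne_zero (a := keyIndex τ A y a) (hpush ▸ h0) (hpush ▸ h1)

/-! ### From the channel matrix to independent Gaussian columns. -/

/-- The columns of `G * Q`. -/
def mulColumns {n N k : ℕ} (Q : Matrix (Fin N) (Fin k) ℂ) (G : Fin n → Fin N → ℂ) :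
    Fin k → Fin n → ℂ :=
  columns (Matrix.of G * Q)

lemma measurable_mulColumns {n N k : ℕ} (Q : Matrix (Fin N) (Fin k) ℂ) :
    Measurable (mulColumns (n := n) Q) := by
  unfold mulColumns columns
  simp only [Matrix.mul_apply, Matrix.of_apply]
  fun_prop

/-- A Gaussian matrix times a matrix with orthonormal columns has Gaussian columns. -/
lemma map_mulColumns {n N k : ℕ} {Q : Matrix (Fin N) (Fin k) ℂ} (hQ : Qᴴ * Q = 1) :
    (complexGaussianPi (Fin n × Fin N)).map (fun z => mulColumns Q fun i j => z (i, j)) =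
      gaussianColumns n k := by
  -- On flattened matrices `G ↦ G * Q` acts on each row of `G` by `Qᵀ`; orthonormality of the
  -- columns of `Q` makes this a coisometry.
  set M : Matrix (Fin k × Fin n) (Fin n × Fin N) ℂ :=
    Matrix.of fun p q => if p.2 = q.1 then Q q.2 p.1 else 0 with hM
  have hMM : M * Mᴴ = 1 := by
    ext ⟨a, i⟩ ⟨b, j⟩
    rw [Matrix.mul_apply, Fintype.sum_prod_type, Finset.sum_eq_single i]
    · by_cases hij : i = j
      · subst hij
        have h := congr_fun (congr_fun hQ b) a
        rw [Matrix.mul_apply] at h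
        simp only [hM, Matrix.of_apply, Matrix.conjTranspose_apply, if_true, Matrix.one_apply,
          Prod.mk.injEq, and_true] at h ⊢
        rw [if_congr (eq_comm (a := a)) rfl rfl, ← h]
        exact Finset.sum_congr rfl fun x _ => mul_comm _ _
      · simp [hM, hij, Ne.symm hij]
    · intro l _ hl
      simp [hM, Ne.symm hl]
    · simp
  have hcurry : (complexGaussianPi (Fin k × Fin n)).map (MeasurableEquiv.curry (Fin k) (Fin n) ℂ) =
      gaussianColumns n k := by
    have h := Measure.infinitePi_map_curry (fun (_ : Fin k) (_ : Fin n) => complexGaussian 1)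
    simpa only [Measure.infinitePi_eq_pi] using h
  have hmeas : Measurable fun z : Fin n × Fin N → ℂ => M *ᵥ z :=
    (Continuous.matrix_mulVec continuous_const continuous_id).measurable
  rw [← hcurry, ← map_mulVec_complexGaussianPi M hMM, Measure.map_map (by fun_prop) hmeas]
  congr 1
  funext z a i
  simp only [mulColumns, columns, Matrix.mul_apply, Matrix.of_apply, Function.comp_apply,
    MeasurableEquiv.coe_curry, Function.curry_apply, Matrix.mulVec, dotProduct, hM,
    Fintype.sum_prod_type]
  rw [Finset.sum_eq_single i]
  · simp [mul_comm]
  · intro l _ hl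
    simp [Ne.symm hl]
  · simp

section Precoder

variable {NA NB : ℕ}

/-- The effective direction of a noise vector followed by the message directions. -/
def directions (h : NB ≤ NA) (V : Matrix (Fin NA) (Fin NA) ℂ)
    (e : EuclideanSpace ℂ (Fin (NA - NB))) : Matrix (Fin NA) (Fin (NB + 1)) ℂ :=
  Matrix.of fun i => Fin.cons ((noiseBlock h V *ᵥ e.ofLp) i) (messageBlock h V i)

/-- `Z` is an isometry with range orthogonal to the columns of `V₁`, so `Z e` completes them to an
orthonormal family. -/
lemma conjTranspose_directions_mul_self (h : NB ≤ NA) {V : Matrix (Fin NA) (Fin NA) ℂ}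
    (hV : V ∈ Matrix.unitaryGroup (Fin NA) ℂ) {e : EuclideanSpace ℂ (Fin (NA - NB))}
    (he : ‖e‖ = 1) : (directions h V e)ᴴ * directions h V e = 1 := by
  have hVV : Vᴴ * V = 1 := Matrix.mem_unitaryGroup_iff'.1 hV
  have hent : ∀ a b, ∑ j, star (V j a) * V j b = if a = b then 1 else 0 := by
    intro a b
    have := congr_fun (congr_fun hVV a) b
    rwa [Matrix.mul_apply, Matrix.one_apply] at this
  set Z := noiseBlock h V with hZ
  set W := messageBlock h V with hW
  have hZZ : Zᴴ * Z = 1 := by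
    ext a b
    rw [Matrix.mul_apply, Matrix.one_apply]
    refine (hent _ _).trans (if_congr ?_ rfl rfl)
    simp [Fin.ext_iff]
  have hWW : Wᴴ * W = 1 := by
    ext a b
    rw [Matrix.mul_apply, Matrix.one_apply]
    refine (hent _ _).trans (if_congr ?_ rfl rfl)
    simp
  have hWZ : Wᴴ * Z = 0 := by
    ext a b
    rw [Matrix.mul_apply]
    refine (hent _ _).trans (if_neg fun hab => ?_)
    have := congr_arg Fin.val hab
    have ha := a.2
    simp only [Fin.val_castLE] at this
    omega
  have hee : star e.ofLp ⬝ᵥ e.ofLp = 1 := by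
    have h1 := EuclideanSpace.inner_eq_star_dotProduct e e
    rw [inner_self_eq_norm_sq_to_K, he] at h1
    rw [dotProduct_comm, ← h1]
    simp
  have hmz : Wᴴ *ᵥ (Z *ᵥ e.ofLp) = 0 := by
    rw [Matrix.mulVec_mulVec, hWZ, Matrix.zero_mulVec]
  ext a b
  rw [Matrix.mul_apply]
  refine Fin.cases ?_ (fun a => ?_) a <;> refine Fin.cases ?_ (fun b => ?_) b
  · change star (Z *ᵥ e.ofLp) ⬝ᵥ (Z *ᵥ e.ofLp) = _
    rw [Matrix.star_mulVec, Matrix.dotProduct_mulVec, Matrix.vecMul_vecMul, hZZ, Matrix.vecMul_one,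
      hee, Matrix.one_apply_eq]
  · have h1 := congr_arg star (congr_fun hmz b)
    rw [Matrix.one_apply_ne (Fin.succ_ne_zero b).symm]
    simp only [Matrix.mulVec, dotProduct, star_sum, star_mul', Matrix.conjTranspose_apply, star_star,
      Pi.zero_apply, star_zero] at h1
    simp only [directions, Matrix.conjTranspose_apply, Matrix.of_apply, Fin.cons_zero,
      Fin.cons_succ, Matrix.mulVec, dotProduct, star_sum, star_mul']
    rw [← h1]
    exact Finset.sum_congr rfl fun j _ => mul_comm _ _
  · rw [Matrix.one_apply_ne (Fin.succ_ne_zero a)]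
    exact congr_fun hmz a
  · have h1 := congr_fun (congr_fun hWW a) b
    rw [Matrix.one_apply] at h1 ⊢
    simp only [Fin.succ_inj]
    exact h1

lemma measurable_mulColumns_directions {n : ℕ} (h : NB ≤ NA) (V : Matrix (Fin NA) (Fin NA) ℂ) :
    Measurable fun q : (Fin n → Fin NA → ℂ) × EuclideanSpace ℂ (Fin (NA - NB)) =>
      mulColumns (directions h V q.2) q.1 := by
  refine measurable_pi_lambda _ fun k => measurable_pi_lambda _ fun i => ?_
  simp only [mulColumns, columns, Matrix.mul_apply, Matrix.of_apply, directions]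
  refine Finset.measurable_fun_sum _ fun j _ => Measurable.mul (by fun_prop) ?_
  refine Fin.cases ?_ (fun b => ?_) k
  · simp only [Fin.cons_zero, Matrix.mulVec, dotProduct]
    fun_prop
  · simp only [Fin.cons_succ]
    fun_prop

lemma mulColumns_directions_zero {n : ℕ} (h : NB ≤ NA) (V : Matrix (Fin NA) (Fin NA) ℂ)
    (e : EuclideanSpace ℂ (Fin (NA - NB))) (G : Fin n → Fin NA → ℂ) :
    WithLp.toLp 2 (mulColumns (directions h V e) G 0) =
      noisePoint (Matrix.of G * noiseBlock h V) e := by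
  unfold noisePoint
  congr 1
  rw [← Matrix.mulVec_mulVec]
  rfl

lemma tail_mulColumns_directions {n : ℕ} (h : NB ≤ NA) (V : Matrix (Fin NA) (Fin NA) ℂ)
    (e : EuclideanSpace ℂ (Fin (NA - NB))) (G : Fin n → Fin NA → ℂ) :
    Fin.tail (mulColumns (directions h V e) G) = columns (Matrix.of G * messageBlock h V) := rfl

end Precoder

open Classical in
/-- The unit vector in the direction of `v`, with the value `e₀` at `0`. -/
def direction {m : ℕ} (e₀ v : EuclideanSpace ℂ (Fin m)) : EuclideanSpace ℂ (Fin m) :=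
  if v = 0 then e₀ else ((‖v‖⁻¹ : ℝ) : ℂ) • v

lemma norm_direction {m : ℕ} {e₀ : EuclideanSpace ℂ (Fin m)} (he₀ : ‖e₀‖ = 1)
    (v : EuclideanSpace ℂ (Fin m)) : ‖direction e₀ v‖ = 1 := by
  unfold direction
  split_ifs with hv
  · exact he₀
  · have : ‖v‖ ≠ 0 := norm_ne_zero_iff.2 hv
    simp [norm_smul, this]

lemma eq_norm_smul_direction {m : ℕ} (e₀ v : EuclideanSpace ℂ (Fin m)) :
    v = (‖v‖ : ℂ) • direction e₀ v := by
  unfold direction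
  split_ifs with hv
  · simp [hv]
  · have : (‖v‖ : ℂ) ≠ 0 := by exact_mod_cast norm_ne_zero_iff.2 hv
    rw [smul_smul, Complex.ofReal_inv, mul_inv_cancel₀ this, one_smul]

lemma measurable_direction {m : ℕ} (e₀ : EuclideanSpace ℂ (Fin m)) : Measurable (direction e₀) := by
  classical
  exact Measurable.ite (measurableSet_singleton 0) measurable_const (by fun_prop)

/-- For Gaussian `G` independent of `v`, the noise direction seen through `G` has a short
projection on the message lattice with small probability. -/
lemma measure_shortProjection_le {NB NE NA : ℕ} (hBE : NB ≤ NE) (hBA : NB ≤ NA)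
    {V : Matrix (Fin NA) (Fin NA) ℂ} (hV : V ∈ Matrix.unitaryGroup (Fin NA) ℂ)
    {Ω : Type*} [MeasurableSpace Ω] (μ : Measure Ω) [IsProbabilityMeasure μ]
    {v : Ω → EuclideanSpace ℂ (Fin (NA - NB))} {G : Ω → Fin NE → Fin NA → ℂ}
    (hv : Measurable v) (hG : Measurable G) (hGv : IndepFun G v μ)
    (hGi : iIndepFun (fun (ij : Fin NE × Fin NA) ω => G ω ij.1 ij.2) μ)
    (hGl : ∀ i j, HasLaw (fun ω => G ω i j) (complexGaussian 1) μ)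
    {e₀ : EuclideanSpace ℂ (Fin (NA - NB))} (he₀ : ‖e₀‖ = 1) {t : ℝ} (ht : 0 ≤ t) :
    μ {ω | mulColumns (directions hBA V (direction e₀ (v ω))) (G ω) ∈ shortProjection NE NB t} ≤
      ENNReal.ofReal (2 * t) ^ (2 * NB) * columnMoment NE NB := by
  have hlaw : μ.map (fun ω (ij : Fin NE × Fin NA) => G ω ij.1 ij.2) =
      complexGaussianPi (Fin NE × Fin NA) := by
    have hm : ∀ ij : Fin NE × Fin NA, AEMeasurable (fun ω => G ω ij.1 ij.2) μ :=
      fun ij => (hGl ij.1 ij.2).aemeasurable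
    rw [(iIndepFun_iff_map_fun_eq_pi_map hm).1 hGi]
    congr 1
    funext ij
    exact (hGl ij.1 ij.2).map_eq
  set T : Set ((Fin NE → Fin NA → ℂ) × EuclideanSpace ℂ (Fin (NA - NB))) :=
    {q | mulColumns (directions hBA V (direction e₀ q.2)) q.1 ∈ shortProjection NE NB t} with hT
  have hTm : MeasurableSet T :=
    ((measurable_mulColumns_directions hBA V).comp
      (measurable_fst.prodMk ((measurable_direction e₀).comp measurable_snd)))
      (measurableSet_shortProjection NE NB t)
  have hprob : IsProbabilityMeasure (μ.map v) := Measure.isProbabilityMeasure_map hv.aemeasurable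
  calc _ = (μ.map fun ω => (G ω, v ω)) T := by
        rw [Measure.map_apply (hG.prodMk hv) hTm]
        rfl
    -- Independence allows freezing `v = w`. The direction is then deterministic and the bound is
    -- uniform in `w`, so the law of the noise plays no role.
    _ = ∫⁻ w, (μ.map G) ((fun x => (x, w)) ⁻¹' T) ∂(μ.map v) := by
        rw [(indepFun_iff_map_prod_eq_prod_map_map hG.aemeasurable hv.aemeasurable).1 hGv,
          Measure.prod_apply_symm hTm]
    _ ≤ ∫⁻ _, ENNReal.ofReal (2 * t) ^ (2 * NB) * columnMoment NE NB ∂(μ.map v) := by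
        refine lintegral_mono fun w => ?_
        rw [Measure.map_apply hG (measurable_prodMk_right hTm)]
        refine le_trans (le_of_eq ?_) (gaussianColumns_shortProjection_le hBE ht)
        have hQ := conjTranspose_directions_mul_self hBA hV (norm_direction he₀ w)
        rw [← map_mulColumns hQ, ← hlaw, Measure.map_map, Measure.map_apply]
        · rfl
        · exact (measurable_mulColumns _).comp (by fun_prop)
        · exact measurableSet_shortProjection NE NB t
        · exact (measurable_mulColumns _).comp (by fun_prop)
        · fun_prop
    _ = _ := by simp

/-! ### The power threshold and the outage constant. -/

lemma kappa_pos {NE d : ℕ} (hd : 0 < d) : 0 < kappa NE d := by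
  have := Real.pi_pos
  unfold kappa
  positivity

lemma Phi_pos (NB NE : ℕ) : 0 < Phi NB NE := by
  unfold Phi
  have := (NE - NB).factorial_pos
  have := NE.factorial_pos
  positivity

/-- The factor of `powerThreshold` that does not depend on `ε`. -/
def thresholdFactor (NB NE d : ℕ) : ℝ := kappa NE d ^ 2 / Phi NB NE ^ (2 * (NB : ℝ) / (NE : ℝ))

lemma thresholdFactor_pos {NB NE d : ℕ} (hd : 0 < d) : 0 < thresholdFactor NB NE d :=
  div_pos (pow_pos (kappa_pos hd) 2) (Real.rpow_pos_of_pos (Phi_pos NB NE) _)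

lemma powerThreshold_eq (NB NE d : ℕ) (ε : ℝ) :
    powerThreshold NB NE d ε = ε ^ (-2 / (Nmin NB NE : ℝ)) * thresholdFactor NB NE d :=
  mul_div_assoc _ _ _

lemma powerThreshold_pos {NB NE d : ℕ} (hd : 0 < d) {ε : ℝ} (hε : 0 < ε) :
    0 < powerThreshold NB NE d ε := by
  rw [powerThreshold_eq]
  exact mul_pos (Real.rpow_pos_of_pos hε _) (thresholdFactor_pos hd)

/-- As `0 < N_min ≤ NB`, the power `Pv ^ NB` gains a factor `ε` to the exponent `-2 NB / N_min ≤
-2`; for `ε ≤ 1` this absorbs the single `ε`. -/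
lemma thresholdFactor_pow_le {NB NE d : ℕ} (hNB : 1 ≤ NB) (hd : 0 < d) {ε Pv : ℝ}
    (hε : 0 < ε) (hε1 : ε ≤ 1) (hPv : powerThreshold NB NE d ε ≤ Pv) :
    thresholdFactor NB NE d ^ NB ≤ ε * Pv ^ NB := by
  have hc := thresholdFactor_pos (NB := NB) (NE := NE) hd
  have hN : 0 < (Nmin NB NE : ℝ) := by
    have : 0 < Nmin NB NE := by unfold Nmin; omega
    exact_mod_cast this
  have hNle : (Nmin NB NE : ℝ) ≤ NB := by
    have : Nmin NB NE ≤ NB := min_le_right _ _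
    exact_mod_cast this
  have h1 : 1 ≤ ε * (ε ^ (-2 / (Nmin NB NE : ℝ))) ^ NB := by
    rw [← Real.rpow_natCast, ← Real.rpow_mul hε.le, ← Real.rpow_one_add' hε.le]
    · refine Real.one_le_rpow_of_pos_of_le_one_of_nonpos hε hε1 ?_
      rw [div_mul_eq_mul_div, ← neg_le_neg_iff]
      rw [neg_zero, neg_add, ← neg_div, le_neg_add_iff_add_le, add_zero, le_div_iff₀ hN]
      linarith
    · have : -2 / (Nmin NB NE : ℝ) * NB ≤ -2 := by
        rw [div_mul_eq_mul_div, div_le_iff₀ hN]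
        linarith
      linarith
  rw [powerThreshold_eq] at hPv
  calc thresholdFactor NB NE d ^ NB
      ≤ (ε * (ε ^ (-2 / (Nmin NB NE : ℝ))) ^ NB) * thresholdFactor NB NE d ^ NB :=
        le_mul_of_one_le_left (by positivity) h1
    _ = ε * (ε ^ (-2 / (Nmin NB NE : ℝ)) * thresholdFactor NB NE d) ^ NB := by
        rw [mul_pow, mul_assoc]
    _ ≤ ε * Pv ^ NB := by
        have := Real.rpow_pos_of_pos hε (-2 / (Nmin NB NE : ℝ))
        gcongr

/-- The constant of the outage bound. -/
def outageConstant (NB NE d : ℕ) : ℝ :=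
  (2 * ((NE * (NB * (1 + d)) : ℕ) : ℝ)) ^ (2 * NB) * (columnMoment NE NB).toReal /
    thresholdFactor NB NE d ^ NB + 2

lemma outageConstant_ge {NB NE d : ℕ} (hd : 0 < d) : 2 ≤ outageConstant NB NE d := by
  have hc := thresholdFactor_pos (NB := NB) (NE := NE) hd
  unfold outageConstant
  have : 0 ≤ (2 * ((NE * (NB * (1 + d)) : ℕ) : ℝ)) ^ (2 * NB) * (columnMoment NE NB).toReal /
    thresholdFactor NB NE d ^ NB := by positivity
  linarith

lemma measureReal_lt_outageConstant {NB NE d : ℕ} (hNB : 1 ≤ NB) (hd : 0 < d) {ε Pv : ℝ}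
    (hε : 0 < ε) (hPv : powerThreshold NB NE d ε ≤ Pv)
    {Ω : Type*} [MeasurableSpace Ω] (μ : Measure Ω) [IsProbabilityMeasure μ] {s : Set Ω}
    (hs : μ s ≤ ENNReal.ofReal (2 * (((NE * (NB * (1 + d)) : ℕ) : ℝ) / √Pv)) ^ (2 * NB) *
      columnMoment NE NB) : μ.real s < outageConstant NB NE d * ε := by
  -- The summand `2` in `outageConstant` makes the claim trivial for `ε > 1` and the final
  -- inequality strict otherwise.
  rcases lt_or_ge 1 ε with hε1 | hε1
  · have h2 := outageConstant_ge (NB := NB) (NE := NE) hd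
    have h1 : μ.real s ≤ 1 := measureReal_le_one
    nlinarith
  set K : ℝ := ((NE * (NB * (1 + d)) : ℕ) : ℝ) with hK
  have hP : 0 < Pv := (powerThreshold_pos hd hε).trans_le hPv
  have hc := thresholdFactor_pos (NB := NB) (NE := NE) hd
  have hle := thresholdFactor_pow_le hNB hd hε hε1 hPv
  have h1 : μ.real s ≤ (2 * (K / √Pv)) ^ (2 * NB) * (columnMoment NE NB).toReal := by
    have h := ENNReal.toReal_mono (ENNReal.mul_ne_top
      (ENNReal.pow_ne_top ENNReal.ofReal_ne_top) (columnMoment_lt_top NE NB).ne) hs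
    rwa [ENNReal.toReal_mul, ENNReal.toReal_pow, ENNReal.toReal_ofReal (by positivity)] at h
  have h2 : (2 * (K / √Pv)) ^ (2 * NB) = (2 * K) ^ (2 * NB) / Pv ^ NB := by
    rw [← mul_div_assoc, div_pow, pow_mul (√Pv), Real.sq_sqrt hP.le]
  have h3 : 1 / Pv ^ NB ≤ ε / thresholdFactor NB NE d ^ NB := by
    rw [div_le_div_iff₀ (by positivity) (by positivity)]
    linarith
  calc μ.real s ≤ (2 * K) ^ (2 * NB) * (columnMoment NE NB).toReal * (1 / Pv ^ NB) := by
        rw [h2] at h1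
        refine h1.trans (le_of_eq ?_)
        ring
    _ ≤ (2 * K) ^ (2 * NB) * (columnMoment NE NB).toReal *
        (ε / thresholdFactor NB NE d ^ NB) := by gcongr
    _ < outageConstant NB NE d * ε := by
        rw [outageConstant, add_mul]
        refine lt_of_eq_of_lt ?_ (lt_add_of_pos_right _ (by positivity : 0 < 2 * ε))
        rw [← hK]
        ring

end USK

end
-- Assembly: one exceptional event controls both outage and failure of secrecy.
theorem theorem2 (NB NE d : ℕ) (hNB : 1 ≤ NB) (hBE : NB ≤ NE) (hd : 2 ≤ d) :
    ∃ C : ℝ, 0 < C ∧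
      ∀ ε : ℝ, 0 < ε → ∀ Pv : ℝ, USK.powerThreshold NB NE d ε ≤ Pv →
      ∀ (NA : ℕ) (hBA : NB < NA), NE < NA →
      -- Bob's channel and its singular value decomposition, `V = [V₁, Z]`
      ∀ (H : Matrix (Fin NB) (Fin NA) ℂ) (U : Matrix (Fin NB) (Fin NB) ℂ)
        (S : Matrix (Fin NB) (Fin NA) ℂ) (V : Matrix (Fin NA) (Fin NA) ℂ),
        USK.IsSVD H U S V →
      -- the message `u`, the artificial noise `v` and Eve's channel `G`
      ∀ (Ω : Type*) [MeasurableSpace Ω] (μ : Measure Ω) [IsProbabilityMeasure μ]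
        (u : Ω → Fin NB → GaussianInt) (v : Ω → EuclideanSpace ℂ (Fin (NA - NB)))
        (G : Ω → Fin NE → Fin NA → ℂ),
        Measurable u → Measurable v → Measurable G →
        (∀ᵐ ω ∂μ, ‖v ω‖ ^ 2 ≤ Pv) →
        IndepFun u v μ → IndepFun G (fun ω => (u ω, v ω)) μ →
        iIndepFun (fun (ij : Fin NE × Fin NA) ω => G ω ij.1 ij.2) μ →
        (∀ i j, HasLaw (fun ω => G ω i j) (USK.complexGaussian 1) μ) →
      let A : Ω → Matrix (Fin NE) (Fin NB) ℂ :=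
        fun ω => Matrix.of (G ω) * USK.messageBlock hBA.le V
      let B : Ω → Matrix (Fin NE) (Fin (NA - NB)) ℂ :=
        fun ω => Matrix.of (G ω) * USK.noiseBlock hBA.le V
      let y : Ω → EuclideanSpace ℂ (Fin NE) := fun ω => USK.received (A ω) (B ω) (u ω) (v ω)
      let D : Ω → ℕ∞ := fun ω => USK.keySpaceSize (A ω) (B ω) Pv (y ω)
      -- the secrecy outage probability is `O(ε)`
      μ.real {ω | D ω < (d : ℕ∞)} < C * ε ∧
      -- ideal secrecy holds with probability `1 - O(ε)`, if every message can occur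
      ((∀ w, μ {ω | u ω = w} ≠ 0) →
        ∀ τ : (Fin NB → GaussianInt) → ℕ, Function.Injective τ →
          μ.real {ω | ¬ USK.IdealSecrecy τ (fun w => μ {ω' | u ω' = w}) (A ω) (B ω) Pv (y ω)}
            < C * ε ∧
          1 - C * ε <
            μ.real {ω | USK.IdealSecrecy τ (fun w => μ {ω' | u ω' = w}) (A ω) (B ω) Pv (y ω)}) := by
  have hd0 : 0 < d := by omega
  refine ⟨USK.outageConstant NB NE d, by linarith [USK.outageConstant_ge (NB := NB) (NE := NE) hd0],
    ?_⟩
  intro ε hε Pv hPv NA hBA _ H U S V hSVD Ω _ μ _ u v G hu hv hG hvP _ hGuv hGi hGl A B y D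
  have hP : 0 < Pv := (USK.powerThreshold_pos hd0 hε).trans_le hPv
  have he₀ : ‖(EuclideanSpace.single ⟨0, by omega⟩ 1 : EuclideanSpace ℂ (Fin (NA - NB)))‖ = 1 := by
    simp
  set e : Ω → EuclideanSpace ℂ (Fin (NA - NB)) :=
    fun ω => USK.direction (EuclideanSpace.single ⟨0, by omega⟩ 1) (v ω)
  set K : ℝ := ((NE * (NB * (1 + d)) : ℕ) : ℝ) with hK
  set bad : Set Ω := {ω | USK.mulColumns (USK.directions hBA.le V (e ω)) (G ω) ∈
    USK.shortProjection NE NB (K / √Pv)} with hbad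
  have hbadm : MeasurableSet bad :=
    ((USK.measurable_mulColumns_directions hBA.le V).comp
      (hG.prodMk ((USK.measurable_direction _).comp hv)))
      (USK.measurableSet_shortProjection NE NB _)
  have hbadC : μ.real bad < USK.outageConstant NB NE d * ε :=
    USK.measureReal_lt_outageConstant hNB hd0 hε hPv μ
      (USK.measure_shortProjection_le hBE hBA.le hSVD.unitary_right μ hv hG
        (hGuv.comp measurable_id measurable_snd) hGi hGl he₀ (by positivity))
  have hgood : ∀ ω, ‖v ω‖ ^ 2 ≤ Pv → ω ∉ bad →
      LinearIndependent ℂ (USK.columns (A ω)) ∧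
      ∃ f : Fin d → Fin NB → GaussianInt, Function.Injective f ∧
        ∀ j, f j ∈ USK.candidates (A ω) (B ω) Pv (y ω) := by
    intro ω hω hωb
    have h : ¬ (_ ∨ _) := hωb
    push Not at h
    obtain ⟨hA, hx⟩ := h
    refine ⟨hA, USK.exists_candidates hNB d hP (USK.norm_direction he₀ (v ω))
      (USK.eq_norm_smul_direction _ _) hω ?_ (u ω)⟩
    obtain ⟨x, hx⟩ := hx
    exact ⟨x, by
      rwa [USK.mulColumns_directions_zero, USK.tail_mulColumns_directions] at hx⟩
  refine ⟨lt_of_le_of_lt (ENNReal.toReal_mono (measure_ne_top _ _) (measure_mono_ae ?_)) hbadC, ?_⟩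
  · filter_upwards [hvP] with ω hω hD
    by_contra hωb
    obtain ⟨hA, f, hf, hfc⟩ := hgood ω hω hωb
    exact absurd (USK.le_keySpaceSize hA hf hfc) (not_le.2 hD)
  · intro hpos τ hτ
    have hsum : ∑' w, μ {ω' | u ω' = w} ≠ ∞ := by
      refine ne_top_of_le_ne_top (measure_ne_top μ (⋃ w, {ω' | u ω' = w})) ?_
      refine tsum_meas_le_meas_iUnion_of_disjoint μ
        (fun w => hu (measurableSet_singleton w)) fun w w' hw => ?_
      refine Set.disjoint_left.2 fun ω h1 h2 => hw ?_
      exact Eq.trans (Eq.symm h1) h2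
    have hideal : ∀ ω, ‖v ω‖ ^ 2 ≤ Pv → ω ∉ bad →
        USK.IdealSecrecy τ (fun w => μ {ω' | u ω' = w}) (A ω) (B ω) Pv (y ω) := by
      intro ω hω hωb
      obtain ⟨hA, f, hf, hfc⟩ := hgood ω hω hωb
      -- Here `2 ≤ d` is needed, to supply two distinct candidates.
      refine USK.idealSecrecy_of_candidates hτ hpos hsum hA (hfc ⟨0, by omega⟩) (hfc ⟨1, by omega⟩)
        (hf.ne (by simp))
    constructor
    · refine lt_of_le_of_lt (ENNReal.toReal_mono (measure_ne_top _ _) (measure_mono_ae ?_)) hbadC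
      filter_upwards [hvP] with ω hω hn
      by_contra hωb
      exact hn (hideal ω hω hωb)
    -- Complementation is applied to `bad`, which is known to be measurable, rather than to the
    -- secrecy event.
    · have h1 : μ.real badᶜ ≤
          μ.real {ω | USK.IdealSecrecy τ (fun w => μ {ω' | u ω' = w}) (A ω) (B ω) Pv (y ω)} := by
        refine ENNReal.toReal_mono (measure_ne_top _ _) (measure_mono_ae ?_)
        filter_upwards [hvP] with ω hω hωb
        exact hideal ω hω hωb
      rw [probReal_compl_eq_one_sub hbadm] at h1
      linarith
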